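/- Let $N = 2^L$ with $L \ge 2$. Consider the following complex $N \times N$ matrices, with indices $k,l \in \{1,\dots,N\}$: the DFT matrix $\mathrm{DFT}_N = \big(e^{-2\pi i (k-1)(l-1)/N}\big)_{k,l}$, the DCT-II matrix $\mathrm{DCT}_N = \big(\cos[\tfrac{\pi}{N}(l-\tfrac12)(k-1)]\big)_{k,l}$, and the DST-II matrix $\mathrm{DST}_N = \big(\sin[\tfrac{\pi}{N}(l-\tfrac12)k]\big)_{k,l}$. For integers $s,t\ge 0$, let $\Sigma_{s,t}$ be the set of pairs $(X,Y)$ of complex $N\times N$ matrices such that each column of $X$ has at most $s$ nonzero entries and each column of $Y$ has at most $t$ nonzero entries. Say that $Z \in \mathbb{C}^{N\times N}$ has a PS-unique (unique up to permutation and scaling) exact factorization in $\Sigma_{s,t}$ if there is a pair $(X,Y)\in\Sigma_{s,t}$ with $Z = XY^{\mathsf T}$ such that, for every $(X',Y')\in\Sigma_{s,t}$ with $X'Y'^{\mathsf T} = Z$, there are a diagonal matrix $D$ with nonzero diagonal entries and a permutation matrix $P$ satisfying $X' = XDP$ and $Y' = YD^{-1}P$. Then each of $\mathrm{DFT}_N$,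 $\mathrm{DCT}_N$ and $\mathrm{DST}_N$ has a PS-unique exact factorization in $\Sigma_{N/2,\,2}$. Moreover, $\mathrm{DFT}_N$ also has a PS-unique exact factorization in $\Sigma_{2,\,N/2}$. -/

import Mathlib

open Matrix

section Framework

variable {m n r : Type*}

/-- The support of a complex matrix: the set of index pairs of its nonzero entries. -/
def matSupp (M : Matrix m r ℂ) : Set (m × r) := {p | M p.1 p.2 ≠ 0}

/-- The model set of an allowed support `S`: all matrices whose support is contained in `S`. -/
def modelSet (S : Set (m × r)) : Set (Matrix m r ℂ) := {M | matSupp M ⊆ S}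

/-- The feasible set of a family `Ω` of pairs of allowed (left, right) supports: the union, over
the pairs in `Ω`, of the products of the two model sets. -/
def feasibleSet (Ω : Set (Set (m × r) × Set (n × r))) : Set (Matrix m r ℂ × Matrix n r ℂ) :=
  ⋃ S ∈ Ω, modelSet S.1 ×ˢ modelSet S.2

/-- The family of supports that are `k`-sparse by column: every column has at most `k` entries. -/
def columnSparse (m r : Type*) (k : ℕ) : Set (Set (m × r)) :=
  {S | ∀ j : r, {i : m | (i, j) ∈ S}.encard ≤ k}

variable [Fintype r] [DecidableEq r]

/-- `(X', Y') ∼ (X, Y)`: equality up to permutation and scaling of the columns, that is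
`X' = X D P` and `Y' = Y D⁻¹ P` for a diagonal matrix `D` with nonzero diagonal entries and a
permutation matrix `P`. -/
def PSEquiv (q p : Matrix m r ℂ × Matrix n r ℂ) : Prop :=
  ∃ (d : r → ℂ) (σ : Equiv.Perm r), (∀ i, d i ≠ 0) ∧
    q.1 = p.1 * diagonal d * σ.permMatrix ℂ ∧
    q.2 = p.2 * diagonal (fun i => (d i)⁻¹) * σ.permMatrix ℂ

/-- The pair `p = (X, Y)` is the PS-unique exact matrix factorization of `Z` in `F`: it lies in
`F`, satisfies `X Yᵀ = Z`, and every factorization of `Z` in `F` is equivalent to it. -/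
def IsPSUniqueEMF (F : Set (Matrix m r ℂ × Matrix n r ℂ)) (Z : Matrix m n ℂ)
    (p : Matrix m r ℂ × Matrix n r ℂ) : Prop :=
  p ∈ F ∧ p.1 * p.2ᵀ = Z ∧ ∀ q ∈ F, q.1 * q.2ᵀ = Z → PSEquiv q p

/-- `Z` admits a PS-unique exact matrix factorization in `F`. -/
def HasPSUniqueEMF (F : Set (Matrix m r ℂ × Matrix n r ℂ)) (Z : Matrix m n ℂ) : Prop :=
  ∃ p, IsPSUniqueEMF F Z p

end Framework

noncomputable section Transforms

/-- The DFT matrix of size `N`; the indices `k, l : Fin N` start at `0`, so `k` and `l` here are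
`k - 1` and `l - 1` in the usual one-based convention (likewise in the next two definitions). -/
def dftMatrix (N : ℕ) : Matrix (Fin N) (Fin N) ℂ :=
  Matrix.of fun k l =>
    Complex.exp (-Complex.I * (2 * (Real.pi : ℂ) / (N : ℂ))) ^ ((k : ℕ) * (l : ℕ))

/-- The DCT-II matrix of size `N`, one-based entries `cos [(π / N) (l - 1/2) (k - 1)]`. -/
def dctMatrix (N : ℕ) : Matrix (Fin N) (Fin N) ℂ :=
  Matrix.of fun k l =>
    ((Real.cos (Real.pi / (N : ℝ) * (((l : ℕ) : ℝ) + 1 / 2) * ((k : ℕ) : ℝ)) : ℝ) : ℂ)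

/-- The DST-II matrix of size `N`, one-based entries `sin [(π / N) (l - 1/2) k]`. -/
def dstMatrix (N : ℕ) : Matrix (Fin N) (Fin N) ℂ :=
  Matrix.of fun k l =>
    ((Real.sin (Real.pi / (N : ℝ) * (((l : ℕ) : ℝ) + 1 / 2) * (((k : ℕ) : ℝ) + 1)) : ℝ) : ℂ)

end Transforms

/-! ### Sparse column supports and equivalence of factorizations. -/

section SparseFactorization

variable {m n r : Type*}

/-! A factorization writes `Z` as a sum of `N` rank-one terms, each supported on a rectangle of at
most `N/2 * 2 = N` entries. When `Z` has no zero entry these rectangles cover all `N²` positions, so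
by counting they are full and tile the grid (`rectangle_partition`). No two terms overlap, so `Z`
has rank one on each tile: its two columns are proportional on its `N/2` rows. Arithmetic modulo
powers of 2 shows that a tile through the constant row `k₀` (index 0 for DFT and DCT) must be the
even rows times a pair `{l, τ l}`, where `τ` is the half-period shift for DFT and reversal for DCT.
The other tiles are then pushed onto the odd rows, where proportionality again forces such pairs.
The supports are thus determined, and on each tile the factors are determined up to scale.
`HasRigidHalves` isolates these properties, and `HasRigidHalves.hasPSUniqueEMF` draws the
conclusion. DST reduces to DCT by reversing rows and changing signs of columns; the last claim
follows from the symmetry of DFT. -/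

theorem mem_feasibleSet_columnSparse {s t : ℕ} {q : Matrix m r ℂ × Matrix n r ℂ} :
    q ∈ feasibleSet (columnSparse m r s ×ˢ columnSparse n r t) ↔
      (∀ j, {i | q.1 i j ≠ 0}.encard ≤ s) ∧ ∀ j, {i | q.2 i j ≠ 0}.encard ≤ t := by
  constructor
  · intro h
    simp only [feasibleSet, Set.mem_iUnion, Set.mem_prod] at h
    obtain ⟨S, ⟨h1, h2⟩, h3, h4⟩ := h
    exact ⟨fun j => (Set.encard_le_encard fun i hi => @h3 (i, j) hi).trans (h1 j),
      fun j => (Set.encard_le_encard fun i hi => @h4 (i, j) hi).trans (h2 j)⟩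
  · rintro ⟨h1, h2⟩
    simp only [feasibleSet, Set.mem_iUnion, Set.mem_prod]
    exact ⟨(matSupp q.1, matSupp q.2), ⟨h1, h2⟩, Set.Subset.rfl, Set.Subset.rfl⟩

theorem encard_setOf_ne_zero [Fintype m] (v : m → ℂ) (s : ℕ) :
    {i | v i ≠ 0}.encard ≤ s ↔ (Finset.univ.filter fun i => v i ≠ 0).card ≤ s := by
  have : {i | v i ≠ 0} = ((Finset.univ.filter fun i => v i ≠ 0 : Finset m) : Set m) := by
    ext; simp
  rw [this, Set.encard_coe_eq_coe_finsetCard]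
  exact Nat.cast_le

variable [Fintype r] [DecidableEq r]

theorem psEquiv_of_columns {q p : Matrix m r ℂ × Matrix n r ℂ} (d : r → ℂ) (φ : Equiv.Perm r)
    (hd : ∀ i, d i ≠ 0) (h1 : ∀ i j, q.1 i j = p.1 i (φ j) * d j)
    (h2 : ∀ i j, q.2 i j = p.2 i (φ j) * (d j)⁻¹) : PSEquiv q p := by
  -- The diagonal factor acts before the permutation, so it is indexed by the columns of `p`.
  refine ⟨d ∘ φ.symm, φ.symm, fun i => hd _, ?_, ?_⟩
  · ext i j
    rw [PEquiv.mul_toMatrix_toPEquiv]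
    simp [h1]
  · ext i j
    rw [PEquiv.mul_toMatrix_toPEquiv]
    simp [h2]

theorem PSEquiv.swap {q p : Matrix m r ℂ × Matrix n r ℂ} (h : PSEquiv q p) :
    PSEquiv q.swap p.swap := by
  obtain ⟨d, σ, hd, h1, h2⟩ := h
  exact ⟨fun i => (d i)⁻¹, σ, fun i => inv_ne_zero (hd i), h2, by simpa using h1⟩

theorem HasPSUniqueEMF.transpose {s t : ℕ} {Z : Matrix m n ℂ}
    (h : HasPSUniqueEMF (feasibleSet (columnSparse m r s ×ˢ columnSparse n r t)) Z) :
    HasPSUniqueEMF (feasibleSet (columnSparse n r t ×ˢ columnSparse m r s)) Zᵀ := by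
  obtain ⟨p, hp, hZ, hu⟩ := h
  rw [mem_feasibleSet_columnSparse] at hp
  refine ⟨p.swap, mem_feasibleSet_columnSparse.2 hp.symm, ?_, fun q hq hqZ => ?_⟩
  · rw [← hZ, Matrix.transpose_mul, Matrix.transpose_transpose]; rfl
  · rw [mem_feasibleSet_columnSparse] at hq
    refine (hu q.swap (mem_feasibleSet_columnSparse.2 hq.symm) ?_).swap
    rw [← Matrix.transpose_transpose Z, ← hqZ, Matrix.transpose_mul, Matrix.transpose_transpose]
    rfl

end SparseFactorization

/-! ### Tilings of a grid by rectangles. -/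

section Partition

variable {m n r : Type*} [Fintype m] [Fintype n] [Fintype r]

/-- If rectangles with sides at most `s` and `t` cover a grid whose size is the largest they can
cover, they are of full size and disjoint. -/
theorem rectangle_partition {s t : ℕ} (hs : 0 < s) (ht : 0 < t)
    (hcard : Fintype.card m * Fintype.card n = Fintype.card r * (s * t))
    (A : r → Finset m) (B : r → Finset n) (hA : ∀ j, (A j).card ≤ s) (hB : ∀ j, (B j).card ≤ t)
    (hcover : ∀ k l, ∃ j, k ∈ A j ∧ l ∈ B j) :
    (∀ j, (A j).card = s) ∧ (∀ j, (B j).card = t) ∧ ∀ k l, ∃! j, k ∈ A j ∧ l ∈ B j := by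
  classical
  let f : m × n → ℕ := fun p => (Finset.univ.filter fun j => p.1 ∈ A j ∧ p.2 ∈ B j).card
  have hf1 : ∀ p ∈ (Finset.univ : Finset (m × n)), 1 ≤ f p := fun p _ => by
    obtain ⟨j, hj⟩ := hcover p.1 p.2
    exact Finset.card_pos.2 ⟨j, by simpa using hj⟩
  have hsum : ∑ p, f p = ∑ j, (A j).card * (B j).card := by
    have := Finset.sum_card_bipartiteAbove_eq_sum_card_bipartiteBelow
      (s := (Finset.univ : Finset (m × n))) (t := (Finset.univ : Finset r))
      (fun p j => p.1 ∈ A j ∧ p.2 ∈ B j)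
    refine this.trans (Finset.sum_congr rfl fun j _ => ?_)
    rw [← Finset.card_product]
    congr 1
    ext p
    simp [Finset.bipartiteBelow]
  have hle : ∀ j ∈ (Finset.univ : Finset r), (A j).card * (B j).card ≤ s * t :=
    fun j _ => Nat.mul_le_mul (hA j) (hB j)
  -- The covering multiplicities are squeezed between equal totals, so both bounds are equalities
  -- term by term.
  have h1 : ∑ p : m × n, 1 ≤ ∑ p, f p := Finset.sum_le_sum hf1
  have h2 : ∑ j, (A j).card * (B j).card ≤ ∑ _j : r, s * t := Finset.sum_le_sum hle
  have h3 : ∑ _p : m × n, 1 = ∑ _j : r, s * t := by simp [hcard]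
  have e1 := (Finset.sum_eq_sum_iff_of_le hf1).1 (by omega)
  have e2 := (Finset.sum_eq_sum_iff_of_le hle).1 (by omega)
  have e3 : ∀ j, (A j).card = s ∧ (B j).card = t := fun j => by
    have h := e2 j (Finset.mem_univ j)
    constructor
    · refine le_antisymm (hA j) (Nat.le_of_mul_le_mul_right (h.symm.le.trans ?_) ht)
      exact Nat.mul_le_mul_left _ (hB j)
    · refine le_antisymm (hB j) (Nat.le_of_mul_le_mul_left (h.symm.le.trans ?_) hs)
      exact Nat.mul_le_mul_right _ (hA j)
  refine ⟨fun j => (e3 j).1, fun j => (e3 j).2, fun k l => ?_⟩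
  obtain ⟨j, hj⟩ := Finset.card_eq_one.1 (e1 (k, l) (Finset.mem_univ _)).symm
  simp only [Finset.ext_iff, Finset.mem_filter, Finset.mem_univ, true_and,
    Finset.mem_singleton] at hj
  exact ⟨j, (hj j).2 rfl, fun i hi => (hj i).1 hi⟩

end Partition

/-! ### Rigidity of proportional columns implies uniqueness. -/

section Rigid

variable {m n : Type*} [Fintype m]

/-- Two columns of `Z` are proportional on a set of rows (for nowhere vanishing `Z`). -/
def ColumnsProportional (Z : Matrix m n ℂ) (R : Finset m) (l l' : n) : Prop :=
  ∀ k ∈ R, ∀ k' ∈ R, Z k l * Z k' l' = Z k' l * Z k l'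

/-- The rows of `Z` are halved by the colour `e`, the columns are paired by `τ` (with `c`
separating each pair), paired columns are proportional on each half of the rows, and no other
proportionality of two columns on half of the rows is possible. -/
structure HasRigidHalves (Z : Matrix m n ℂ) (h : ℕ) (e : m → Bool) (c : n → Bool) (τ : n → n)
    (a : Bool → n → ℂ) (k₀ : m) : Prop where
  ne_zero : ∀ k l, Z k l ≠ 0
  pos : 0 < h
  card : Fintype.card m = 2 * h
  card_le : ∀ b, (Finset.univ.filter fun k => e k = b).card ≤ h
  invol : ∀ l, τ (τ l) = l
  flip : ∀ l, c (τ l) = !c l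
  apply_invol : ∀ k l, Z k (τ l) = a (e k) l * Z k l
  rigid : ∀ (R : Finset m) (l l' : n), k₀ ∈ R → R.card = h → l ≠ l' →
    ColumnsProportional Z R l l' → l' = τ l ∧ ∀ k ∈ R, e k = true
  rigid_compl : ∀ l l' : n, l ≠ l' →
    ColumnsProportional Z (Finset.univ.filter fun k => e k = false) l l' → l' = τ l

namespace HasRigidHalves

variable {Z : Matrix m n ℂ} {h : ℕ} {e : m → Bool} {c : n → Bool} {τ : n → n}
  {a : Bool → n → ℂ} {k₀ : m}

theorem eq_half (H : HasRigidHalves Z h e c τ a k₀) {R : Finset m} {b : Bool} (hR : R.card = h)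
    (hb : ∀ k ∈ R, e k = b) : R = Finset.univ.filter fun k => e k = b :=
  Finset.eq_of_subset_of_card_le (fun k hk => by simpa using hb k hk) (hR ▸ H.card_le b)

theorem invol_ne (H : HasRigidHalves Z h e c τ a k₀) (l : n) : τ l ≠ l := fun hl => by
  have := H.flip l
  rw [hl] at this
  cases hc : c l <;> simp [hc] at this

theorem permute_scale (H : HasRigidHalves Z h e c τ a k₀) (ρ : Equiv.Perm m) (s : n → ℂ)
    (hs : ∀ l, s l ≠ 0) :
    HasRigidHalves (Matrix.of fun k l => Z (ρ k) l * s l) h (e ∘ ρ) c τ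
      (fun b l => a b l * (s (τ l) / s l)) (ρ.symm k₀) := by
  have key : ∀ (R : Finset m) (l l' : n),
      ColumnsProportional (Matrix.of fun k l => Z (ρ k) l * s l) R l l' →
      ColumnsProportional Z (R.map ρ.toEmbedding) l l' := by
    intro R l l' hp k hk k' hk'
    simp only [Finset.mem_map_equiv] at hk hk'
    have := hp _ hk _ hk'
    simp only [Matrix.of_apply, Equiv.apply_symm_apply] at this
    exact mul_right_cancel₀ (mul_ne_zero (hs l) (hs l')) (by linear_combination this)
  have hmap : ∀ b, (Finset.univ.filter fun k => (e ∘ ρ) k = b).map ρ.toEmbedding =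
      Finset.univ.filter fun k => e k = b := fun b => by
    ext k
    simp [Finset.mem_map_equiv]
  refine ⟨fun k l => mul_ne_zero (H.ne_zero _ _) (hs l), H.pos, H.card, fun b => ?_, H.invol,
    H.flip, fun k l => ?_, fun R l l' hk hR hne hp => ?_, fun l l' hne hp => ?_⟩
  · rw [← Finset.card_map ρ.toEmbedding, hmap]
    exact H.card_le b
  · have := hs l
    simp only [Matrix.of_apply, H.apply_invol, Function.comp_apply]
    field_simp
  · obtain ⟨h1, h2⟩ := H.rigid _ l l' (by simpa [Finset.mem_map_equiv] using hk)
      ((Finset.card_map _).trans hR) hne (key R l l' hp)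
    exact ⟨h1, fun k hk => h2 _ (by simpa [Finset.mem_map_equiv] using hk)⟩
  · refine H.rigid_compl l l' hne ?_
    rw [← hmap]
    exact key _ l l' hp

variable [Fintype n]

/-- Each pair `{i, τ i}` carries two tiles, one per half of the rows. Since `c` separates the pair,
the tile on the half `c i` can be labelled by `i`, so tiles are indexed by `n`. -/
theorem exists_column (H : HasRigidHalves Z h e c τ a k₀) {X : Matrix m n ℂ} {Y : Matrix n n ℂ}
    (hX : ∀ j, (Finset.univ.filter fun i => X i j ≠ 0).card = h)
    (hY : ∀ j, (Finset.univ.filter fun i => Y i j ≠ 0).card = 2)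
    (hu : ∀ k l, ∃! j, X k j ≠ 0 ∧ Y l j ≠ 0)
    (hZ : ∀ k l j, X k j ≠ 0 → Y l j ≠ 0 → X k j * Y l j = Z k l) (j : n) :
    ∃ i, (∀ k, X k j ≠ 0 ↔ e k = c i) ∧ ∀ l, Y l j ≠ 0 ↔ l = i ∨ l = τ i := by
  classical
  have prop : ∀ j l l', Y l j ≠ 0 → Y l' j ≠ 0 →
      ColumnsProportional Z (Finset.univ.filter fun i => X i j ≠ 0) l l' := by
    intro j l l' hl hl' k hk k' hk'
    simp only [Finset.mem_filter, Finset.mem_univ, true_and] at hk hk'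
    rw [← hZ k l j hk hl, ← hZ k' l' j hk' hl', ← hZ k' l j hk' hl, ← hZ k l' j hk hl']
    ring
  have main : ∀ j, X k₀ j ≠ 0 → ∀ l l', l ≠ l' → Y l j ≠ 0 → Y l' j ≠ 0 →
      l' = τ l ∧ Finset.univ.filter (fun i => X i j ≠ 0) =
        Finset.univ.filter fun k => e k = true := by
    intro j hj l l' hne hl hl'
    obtain ⟨h1, h2⟩ := H.rigid _ l l' (by simpa using hj) (hX j) hne (prop j l l' hl hl')
    exact ⟨h1, H.eq_half (hX j) h2⟩
  have partner : ∀ j l, Y l j ≠ 0 → ∃ l', l ≠ l' ∧ Y l' j ≠ 0 ∧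
      ∀ i, Y i j ≠ 0 ↔ i = l ∨ i = l' := by
    intro j l hl
    obtain ⟨u, v, huv, hs⟩ := Finset.card_eq_two.1 (hY j)
    have hs' : ∀ i, Y i j ≠ 0 ↔ i = u ∨ i = v := fun i => by
      have := Finset.ext_iff.1 hs i
      simpa using this
    rcases (hs' l).1 hl with rfl | rfl
    · exact ⟨v, huv, (hs' v).2 (Or.inr rfl), hs'⟩
    · exact ⟨u, huv.symm, (hs' u).2 (Or.inl rfl), fun i => (hs' i).trans or_comm⟩
  obtain ⟨l, hl⟩ : ∃ l, Y l j ≠ 0 := by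
    have : (Finset.univ.filter fun i => Y i j ≠ 0).Nonempty := by
      rw [← Finset.card_pos, hY j]; exact two_pos
    obtain ⟨l, hl⟩ := this
    exact ⟨l, by simpa using hl⟩
  obtain ⟨l', hne, hl', hC⟩ := partner j l hl
  have hhalf : l' = τ l ∧ ∃ b, Finset.univ.filter (fun i => X i j ≠ 0) =
      Finset.univ.filter fun k => e k = b := by
    by_cases hj : X k₀ j ≠ 0
    · obtain ⟨h1, h2⟩ := main j hj l l' hne hl hl'
      exact ⟨h1, true, h2⟩
    -- The tile through `(k₀, l)` already fills the `true` half in column `l`; disjointness leaves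
    -- only the `false` half.
    · obtain ⟨s, ⟨hs1, hs2⟩, -⟩ := hu k₀ l
      obtain ⟨l'', hne', hl'', -⟩ := partner s l hs2
      have hs := (main s hs1 l l'' hne' hs2 hl'').2
      have hR : Finset.univ.filter (fun i => X i j ≠ 0) =
          Finset.univ.filter fun k => e k = false := by
        refine H.eq_half (hX j) fun k hk => ?_
        simp only [Finset.mem_filter, Finset.mem_univ, true_and] at hk
        by_contra hek
        have hk' : k ∈ Finset.univ.filter (fun i => X i s ≠ 0) := by
          rw [hs]; simpa using hek
        simp only [Finset.mem_filter, Finset.mem_univ, true_and] at hk'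
        have := (hu k l).unique ⟨hk, hl⟩ ⟨hk', hs2⟩
        exact hj (this ▸ hs1)
      refine ⟨H.rigid_compl l l' hne ?_, false, hR⟩
      rw [← hR]
      exact prop j l l' hl hl'
  obtain ⟨rfl, b, hb⟩ := hhalf
  have hb' : ∀ k, X k j ≠ 0 ↔ e k = b := fun k => by
    have := Finset.ext_iff.1 hb k
    simpa using this
  by_cases hc : b = c l
  · exact ⟨l, hc ▸ hb', hC⟩
  · refine ⟨τ l, ?_, fun i => by rw [hC, H.invol, or_comm]⟩
    have : b = c (τ l) := by
      rw [H.flip]; revert hc; cases b <;> cases c l <;> simp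
    exact this ▸ hb'

variable [DecidableEq n]

/-- The left factor supported on the halves of the columns. -/
def leftFactor (Z : Matrix m n ℂ) (e : m → Bool) (c : n → Bool) : Matrix m n ℂ :=
  Matrix.of fun k j => if e k = c j then Z k j else 0

/-- The right factor supported on the pairs of columns. -/
def rightFactor (c : n → Bool) (τ : n → n) (a : Bool → n → ℂ) : Matrix n n ℂ :=
  Matrix.of fun l j => if l = j then 1 else if l = τ j then a (c j) j else 0

theorem leftFactor_mul_rightFactor (H : HasRigidHalves Z h e c τ a k₀) :
    leftFactor Z e c * (rightFactor c τ a)ᵀ = Z := by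
  ext k l
  rw [Matrix.mul_apply, ← Finset.sum_subset (Finset.subset_univ {l, τ l}),
    Finset.sum_pair (H.invol_ne l).symm]
  · simp only [leftFactor, rightFactor, Matrix.of_apply, Matrix.transpose_apply, H.flip, H.invol,
      if_neg (H.invol_ne l).symm, if_true]
    by_cases hc : e k = c l
    · simp [hc]
    · have hc' : e k = !c l := by revert hc; cases e k <;> cases c l <;> simp
      have := H.apply_invol k (τ l)
      rw [H.invol, hc'] at this
      simpa [hc', mul_comm] using this.symm
  · intro j _ hj
    simp only [Finset.mem_insert, Finset.mem_singleton, not_or] at hj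
    have h2 : l ≠ τ j := fun hl => hj.2 (by rw [hl, H.invol])
    simp [rightFactor, Ne.symm hj.1, h2]

theorem hasPSUniqueEMF (H : HasRigidHalves Z h e c τ a k₀) :
    HasPSUniqueEMF (feasibleSet (columnSparse m n h ×ˢ columnSparse n n 2)) Z := by
  refine ⟨(leftFactor Z e c, rightFactor c τ a), ?_, H.leftFactor_mul_rightFactor, ?_⟩
  · simp only [mem_feasibleSet_columnSparse, encard_setOf_ne_zero]
    refine ⟨fun j => (Finset.card_le_card fun k hk => ?_).trans (H.card_le (c j)),
      fun j => (Finset.card_le_card fun l hl => ?_).trans (Finset.card_le_two (a := j) (b := τ j))⟩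
    · by_contra hk'
      simp only [Finset.mem_filter, Finset.mem_univ, true_and] at hk hk'
      simp [leftFactor, hk'] at hk
    · by_contra hl'
      simp only [Finset.mem_insert, Finset.mem_singleton, not_or] at hl'
      simp only [Finset.mem_filter, Finset.mem_univ, true_and] at hl
      simp [rightFactor, hl'] at hl
  rintro ⟨X, Y⟩ hq hZ
  simp only [mem_feasibleSet_columnSparse, encard_setOf_ne_zero] at hq
  have happ : ∀ k l, ∑ j, X k j * Y l j = Z k l := fun k l => by
    rw [← hZ, Matrix.mul_apply]; rfl
  obtain ⟨hX, hY, hu⟩ := rectangle_partition H.pos two_pos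
    (by rw [H.card]; ring) _ _ hq.1 hq.2 (fun k l => by
      by_contra! hcon
      refine H.ne_zero k l (happ k l ▸ Finset.sum_eq_zero fun j _ => ?_)
      have := hcon j
      by_cases hk : X k j = 0
      · simp [hk]
      · simp [hk] at this
        simp [this])
  simp only [Finset.mem_filter, Finset.mem_univ, true_and] at hu
  have hZ' : ∀ k l j, X k j ≠ 0 → Y l j ≠ 0 → X k j * Y l j = Z k l := fun k l j hk hl => by
    rw [← happ k l]
    refine (Finset.sum_eq_single_of_mem (f := fun i => X k i * Y l i) j (Finset.mem_univ j)
      fun i _ hi => ?_).symm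
    by_contra hne
    exact hi ((hu k l).unique ⟨left_ne_zero_of_mul hne, right_ne_zero_of_mul hne⟩ ⟨hk, hl⟩)
  choose φ hφX hφY using H.exists_column hX hY hu hZ'
  have hrow : ∀ j, ∃ k, X k j ≠ 0 := fun j => by
    have : (Finset.univ.filter fun i => X i j ≠ 0).Nonempty := by
      rw [← Finset.card_pos, hX j]; exact H.pos
    obtain ⟨k, hk⟩ := this
    exact ⟨k, by simpa using hk⟩
  have hinj : Function.Injective φ := fun i j hij => by
    obtain ⟨k, hk⟩ := hrow i
    refine (hu k (φ i)).unique ⟨hk, (hφY i _).2 (Or.inl rfl)⟩ ⟨?_, ?_⟩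
    · rw [hφX, ← hij, ← hφX]; exact hk
    · rw [hφY, ← hij]; exact Or.inl rfl
  have hpiv : ∀ j, Y (φ j) j ≠ 0 := fun j => (hφY j _).2 (Or.inl rfl)
  -- The reference right factor has unit diagonal, so the pivot entry of `Y` gives the scale.
  refine psEquiv_of_columns (fun j => (Y (φ j) j)⁻¹)
    (Equiv.ofBijective φ (Finite.injective_iff_bijective.1 hinj))
    (fun j => inv_ne_zero (hpiv j)) (fun k j => ?_) (fun l j => ?_)
  · simp only [Equiv.ofBijective_apply, leftFactor, Matrix.of_apply]
    by_cases hk : X k j ≠ 0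
    · rw [if_pos ((hφX j k).1 hk), ← hZ' k (φ j) j hk (hpiv j),
        mul_inv_cancel_right₀ (hpiv j)]
    · rw [if_neg (fun h => hk ((hφX j k).2 h)), zero_mul]
      exact not_not.1 hk
  · simp only [Equiv.ofBijective_apply, rightFactor, Matrix.of_apply, inv_inv]
    by_cases h1 : l = φ j
    · rw [if_pos h1, h1, one_mul]
    · rw [if_neg h1]
      by_cases h2 : l = τ (φ j)
      · rw [if_pos h2, h2]
        obtain ⟨k, hk⟩ := hrow j
        have e1 := hZ' k (φ j) j hk (hpiv j)
        have e2 := hZ' k (τ (φ j)) j hk ((hφY j _).2 (Or.inr rfl))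
        rw [H.apply_invol, (hφX j k).1 hk, ← e1] at e2
        refine mul_left_cancel₀ hk (e2.trans (by ring))
      · rw [if_neg h2, zero_mul]
        by_contra hne
        exact ((hφY j l).1 hne).elim h1 h2

end HasRigidHalves

end Rigid

/-! ### Parity and 2-adic divisibility. -/

section Parity

/-- The even rows of a matrix. -/
def evenRow {N : ℕ} (k : Fin N) : Bool := decide ((k : ℕ) % 2 = 0)

theorem card_filter_evenRow_le {N h : ℕ} (hN : N = 2 * h) (b : Bool) :
    (Finset.univ.filter fun k : Fin N => evenRow k = b).card ≤ h := by
  rw [← Finset.card_range h]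
  refine Finset.card_le_card_of_injOn (fun k => (k : ℕ) / 2) (fun k _ => ?_) fun k hk k' hk' hkk => ?_
  · have := k.2
    simp only [Finset.coe_range, Set.mem_Iio]
    omega
  · simp only [evenRow] at hk hk'
    have hkk : (k : ℕ) / 2 = k' / 2 := hkk
    ext
    cases b <;> simp at hk hk' <;> omega

/-- Only `N / 4` indices are multiples of 4, too few to fill half of the rows. -/
theorem exists_not_four_dvd {N h : ℕ} (hN : N = 2 * h) (h4 : 4 ∣ N) (hpos : 0 < h)
    (R : Finset (Fin N)) (hR : R.card = h) : ∃ k ∈ R, ¬ (4 : ℤ) ∣ ((k : ℕ) : ℤ) := by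
  by_contra! hcon
  have hle : R.card ≤ (Finset.range (N / 4)).card := by
    refine Finset.card_le_card_of_injOn (fun k => (k : ℕ) / 4) (fun k _ => ?_)
      fun k hk k' hk' hkk => ?_
    · have := k.2
      simp only [Finset.coe_range, Set.mem_Iio]
      omega
    · have h1 := hcon k hk
      have h2 := hcon k' hk'
      have hkk : (k : ℕ) / 4 = k' / 4 := hkk
      ext
      omega
  rw [hR, Finset.card_range] at hle
  omega

/-- Such a `k` absorbs at most one factor 2. -/
theorem two_pow_dvd_of_not_four_dvd {k d : ℤ} {j : ℕ} (hk : ¬ 4 ∣ k) (h : 2 ^ (j + 1) ∣ k * d) :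
    2 ^ j ∣ d := by
  rcases Int.even_or_odd' k with ⟨u, rfl | rfl⟩
  · have hu : IsCoprime ((2 : ℤ) ^ j) u := by
      rcases Int.even_or_odd' u with ⟨v, rfl | rfl⟩
      · exact absurd ⟨v, by ring⟩ hk
      · exact IsCoprime.pow_left ⟨-v, 1, by ring⟩
    rw [pow_succ', mul_assoc] at h
    exact hu.dvd_of_dvd_mul_left ((mul_dvd_mul_iff_left two_ne_zero).1 h)
  · have hu : IsCoprime ((2 : ℤ) ^ (j + 1)) (2 * u + 1) := by
      exact IsCoprime.pow_left ⟨-u, 1, by ring⟩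
    exact (pow_dvd_pow 2 (Nat.le_succ j)).trans (hu.dvd_of_dvd_mul_left h)

end Parity

/-! ### Rigidity of the DFT matrix. -/

section DFT

theorem IsPrimitiveRoot.dvd_sub_of_pow_eq {N : ℕ} (hN : N ≠ 0) {ζ : ℂ} (hζ : IsPrimitiveRoot ζ N)
    {a b : ℕ} (hab : ζ ^ a = ζ ^ b) : (N : ℤ) ∣ a - b := by
  have h0 := hζ.ne_zero hN
  rw [← hζ.zpow_eq_one_iff_dvd, zpow_sub₀ h0, zpow_natCast, zpow_natCast, hab, div_self]
  exact pow_ne_zero _ h0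

theorem isPrimitiveRoot_dft {N : ℕ} (hN : N ≠ 0) :
    IsPrimitiveRoot (Complex.exp (-Complex.I * (2 * (Real.pi : ℂ) / (N : ℂ)))) N := by
  have := (Complex.isPrimitiveRoot_exp N hN).inv
  rw [← Complex.exp_neg] at this
  rwa [show -(2 * (Real.pi : ℂ) * Complex.I / N) = -Complex.I * (2 * Real.pi / N) by ring] at this

theorem transpose_dftMatrix (N : ℕ) : (dftMatrix N)ᵀ = dftMatrix N := by
  ext k l
  simp [dftMatrix, mul_comm]

/-- Translation by half of the period. -/
def halfShift {N h : ℕ} (hN : N = 2 * h) (l : Fin N) : Fin N :=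
  ⟨if (l : ℕ) < h then l + h else l - h, by have := l.2; split_ifs <;> omega⟩

theorem dftMatrix_hasRigidHalves {L N h : ℕ} (hL : 2 ≤ L) (hN : N = 2 ^ L) (hh : N = 2 * h) :
    ∃ c τ a k₀, HasRigidHalves (dftMatrix N) h evenRow c τ a k₀ := by
  obtain ⟨M, rfl⟩ := Nat.exists_eq_add_of_le' hL
  have h4 : N = 4 * 2 ^ M := by rw [hN]; ring
  have hM : 0 < 2 ^ M := by positivity
  have hNZ : (N : ℤ) = 2 ^ (M + 1 + 1) := by exact_mod_cast hN
  have hhZ : (h : ℤ) = 2 ^ (M + 1) := by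
    have : (N : ℤ) = 2 * h := by exact_mod_cast hh
    rw [hNZ, pow_succ'] at this
    linarith
  have hpos : 0 < h := by omega
  have hN0 : N ≠ 0 := by omega
  set ζ := Complex.exp (-Complex.I * (2 * (Real.pi : ℂ) / (N : ℂ))) with hζdef
  have hζ : IsPrimitiveRoot ζ N := isPrimitiveRoot_dft hN0
  have hζ0 := hζ.ne_zero hN0
  have hent : ∀ k l : Fin N, dftMatrix N k l = ζ ^ ((k : ℕ) * (l : ℕ)) := fun k l => rfl
  have hhalf : ζ ^ h = -1 :=
    (hζ.pow (Nat.pos_of_ne_zero hN0) (hh.trans (mul_comm _ _))).eq_neg_one_of_two_right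
  have hshift : ∀ l l' : Fin N, l ≠ l' → (h : ℤ) ∣ (l : ℕ) - (l' : ℕ) → l' = halfShift hh l := by
    rintro l l' hne ⟨q, hq⟩
    have hne' : (l : ℕ) ≠ l' := fun e => hne (Fin.ext e)
    have := l.2
    have := l'.2
    have hq1 : q < 2 := by by_contra! hcon; nlinarith
    have hq2 : -2 < q := by by_contra! hcon; nlinarith
    apply Fin.ext
    simp only [halfShift]
    interval_cases q <;> split_ifs <;> omega
  have hsign : ∀ k : Fin N, ζ ^ ((k : ℕ) * h) = if evenRow k then 1 else -1 := fun k => by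
    rw [mul_comm, pow_mul, hhalf]
    rcases Nat.even_or_odd k with hk | hk
    · simp [hk.neg_one_pow, evenRow, Nat.even_iff.1 hk]
    · simp [hk.neg_one_pow, evenRow, Nat.odd_iff.1 hk]
  refine ⟨fun l => decide ((l : ℕ) < h), halfShift hh, fun b _ => if b then 1 else -1, ⟨0, by omega⟩,
    fun k l => pow_ne_zero _ hζ0, hpos, by simpa using hh, card_filter_evenRow_le hh, fun l => ?_,
    fun l => ?_, fun k l => ?_, fun R l l' hk₀ hR hne hp => ?_, fun l l' hne hp => ?_⟩
  · have := l.2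
    apply Fin.ext
    simp only [halfShift]
    split_ifs <;> omega
  · have := l.2
    by_cases hl : (l : ℕ) < h <;> simp [halfShift, hl]
    omega
  · rw [hent, hent, ← hsign, ← pow_add]
    by_cases hl : (l : ℕ) < h
    · simp only [halfShift, if_pos hl]
      congr 1; ring
    · simp only [halfShift, if_neg hl]
      obtain ⟨u, hu⟩ := Nat.exists_eq_add_of_le (not_lt.1 hl)
      have hsplit : (k : ℕ) * h + k * (h + u) = 2 * h * k + k * u := by ring
      rw [hu, Nat.add_sub_cancel_left, hsplit, pow_add, pow_mul _ (2 * h), ← hh, hζ.pow_eq_one,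
        one_pow, one_mul]
  -- Row 0 is constantly 1, so proportional columns are equal on `R`.
  · have hdvd : ∀ k ∈ R, (N : ℤ) ∣ (k : ℕ) * ((l : ℕ) - (l' : ℕ)) := fun k hk => by
      have := hp _ hk₀ _ hk
      simp only [hent, zero_mul, pow_zero, one_mul, mul_one] at this
      have := hζ.dvd_sub_of_pow_eq hN0 this.symm
      push_cast at this
      rwa [← mul_sub] at this
    have hsh : l' = halfShift hh l := by
      obtain ⟨k, hk, hk4⟩ := exists_not_four_dvd hh ⟨_, h4⟩ hpos R hR
      have := hdvd k hk
      rw [hNZ] at this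
      exact hshift l l' hne (hhZ ▸ two_pow_dvd_of_not_four_dvd hk4 this)
    refine ⟨hsh, fun k hk => ?_⟩
    have hd := hdvd k hk
    have hl' : (l : ℤ) - ((l' : ℕ) : ℤ) = h ∨ (l : ℤ) - ((l' : ℕ) : ℤ) = -h := by
      rw [hsh]; simp only [halfShift]; split_ifs <;> omega
    have h2 : (2 * h : ℤ) ∣ (k : ℕ) * h := by
      have hNc : (N : ℤ) = 2 * h := by exact_mod_cast hh
      rw [hNc] at hd
      rcases hl' with e | e
      · rwa [e] at hd
      · rwa [e, mul_neg, dvd_neg] at hd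
    have := (mul_dvd_mul_iff_right (by exact_mod_cast hpos.ne')).1 h2
    simp only [evenRow, decide_eq_true_eq]
    omega
  -- Rows 1 and 3 suffice: their exponents differ by 2, giving `N ∣ 2 (l - l')`.
  · have h1 : (1 : ℕ) < N := by omega
    have h3 : (3 : ℕ) < N := by omega
    have := hp ⟨1, h1⟩ (by simp [evenRow]) ⟨3, h3⟩ (by simp [evenRow])
    simp only [hent, ← pow_add] at this
    have := hζ.dvd_sub_of_pow_eq hN0 this
    push_cast at this
    refine hshift l l' hne ?_
    obtain ⟨q, hq⟩ := this
    refine ⟨-q, ?_⟩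
    have hNc : (N : ℤ) = 2 * h := by exact_mod_cast hh
    rw [hNc] at hq
    linarith

end DFT

/-! ### Rigidity of the DCT-II matrix. -/

section DCT

/-- In units of `π / (2N)` the DCT angles are integers and the period is `4N`. -/
theorem dvd_of_cos_eq_cos {N : ℕ} (hN : 0 < N) {A B : ℤ}
    (h : Real.cos (Real.pi * A / (2 * N)) = Real.cos (Real.pi * B / (2 * N))) :
    (4 * N : ℤ) ∣ B - A ∨ (4 * N : ℤ) ∣ A + B := by
  have hN' : (N : ℝ) ≠ 0 := by positivity
  have hpi := Real.pi_ne_zero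
  obtain ⟨q, hq | hq⟩ := Real.cos_eq_cos_iff.1 h
  · refine Or.inl ⟨q, ?_⟩
    field_simp at hq
    have : (B : ℝ) - A = 4 * N * q := by linarith
    exact_mod_cast this
  · refine Or.inr ⟨q, ?_⟩
    field_simp at hq
    have : (A : ℝ) + B = 4 * N * q := by linarith
    exact_mod_cast this

theorem dctMatrix_apply {N : ℕ} (k l : Fin N) :
    dctMatrix N k l =
      (Real.cos (Real.pi * ((k * (2 * l + 1) : ℕ) : ℤ) / (2 * N)) : ℂ) := by
  simp only [dctMatrix, Matrix.of_apply]
  congr 2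
  push_cast
  ring

theorem dctMatrix_hasRigidHalves {L N h : ℕ} (hL : 2 ≤ L) (hN : N = 2 ^ L) (hh : N = 2 * h) :
    ∃ c a k₀, HasRigidHalves (dctMatrix N) h evenRow c Fin.rev a k₀ := by
  obtain ⟨M, rfl⟩ := Nat.exists_eq_add_of_le' hL
  have h4 : N = 4 * 2 ^ M := by rw [hN]; ring
  have hM : 0 < 2 ^ M := by positivity
  have hNZ : (N : ℤ) = 2 ^ (M + 2) := by exact_mod_cast hN
  have hNc : (N : ℤ) = 2 * h := by exact_mod_cast hh
  have hpos : 0 < h := by omega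
  have hN0 : 0 < N := by omega
  have hNr : (N : ℝ) ≠ 0 := by positivity
  have hne0 : ∀ k l : Fin N, dctMatrix N k l ≠ 0 := fun k l => by
    rw [dctMatrix_apply, Complex.ofReal_ne_zero, Real.cos_ne_zero_iff]
    intro q hq
    have hpi := Real.pi_ne_zero
    field_simp at hq
    have hq : (((k * (2 * l + 1) : ℕ) : ℤ) : ℝ) = N * (2 * q + 1) := by linarith
    have hq : ((k * (2 * l + 1) : ℕ) : ℤ) = N * (2 * q + 1) := by exact_mod_cast hq
    have hcop : Nat.Coprime N (2 * l + 1) :=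
      hN.symm ▸ Nat.Coprime.pow_left (M + 2) (k := 2 * (l : ℕ) + 1) (by simp)
    have hdvd : N ∣ k * (2 * l + 1) := by
      rw [← Int.natCast_dvd_natCast, hq]
      exact dvd_mul_right _ _
    have hk0 := Nat.eq_zero_of_dvd_of_lt (hcop.dvd_of_dvd_mul_right hdvd) k.2
    rw [hk0, zero_mul, Nat.cast_zero] at hq
    have := mul_eq_zero.1 hq.symm
    omega
  have hrev : ∀ l l' : Fin N, l ≠ l' →
      ((N : ℤ) ∣ (l' : ℕ) - (l : ℕ) ∨ (N : ℤ) ∣ (l : ℕ) + (l' : ℕ) + 1) → l' = l.rev := by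
    intro l l' hne hd
    have hne' : (l : ℕ) ≠ l' := fun e => hne (Fin.ext e)
    have := l.2
    have := l'.2
    apply Fin.ext
    rw [Fin.val_rev]
    rcases hd with ⟨q, hq⟩ | ⟨q, hq⟩
    · have hq1 : q < 1 := by by_contra! hcon; nlinarith
      have hq2 : -1 < q := by by_contra! hcon; nlinarith
      obtain rfl : q = 0 := by omega
      omega
    · have hq1 : q < 2 := by by_contra! hcon; nlinarith
      have hq2 : 0 < q := by by_contra! hcon; nlinarith
      obtain rfl : q = 1 := by omega
      omega
  refine ⟨fun l => decide ((l : ℕ) < h), fun b _ => if b then 1 else -1, ⟨0, by omega⟩,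
    hne0, hpos, by simpa using hh, card_filter_evenRow_le hh, Fin.rev_rev,
    fun l => ?_, fun k l => ?_, fun R l l' hk₀ hR hne hp => ?_, fun l l' hne hp => ?_⟩
  · have := l.2
    by_cases hl : (l : ℕ) < h <;> simp [hl] <;> omega
  · have hcos : Real.cos (Real.pi / (N : ℝ) * (((l.rev : ℕ) : ℝ) + 1 / 2) * ((k : ℕ) : ℝ)) =
        (-1) ^ (k : ℕ) * Real.cos (Real.pi / (N : ℝ) * (((l : ℕ) : ℝ) + 1 / 2) * ((k : ℕ) : ℝ)) := by
      rw [← Real.cos_nat_mul_pi_sub, Fin.val_rev, Nat.cast_sub l.2]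
      congr 1
      push_cast
      field_simp
      ring
    simp only [dctMatrix, Matrix.of_apply, hcos]
    rcases Nat.even_or_odd k with hk | hk
    · simp [hk.neg_one_pow, evenRow, Nat.even_iff.1 hk]
    · simp [hk.neg_one_pow, evenRow, Nat.odd_iff.1 hk]
  · have hdvd : ∀ k ∈ R, (2 * N : ℤ) ∣ (k : ℕ) * ((l' : ℕ) - (l : ℕ)) ∨
        (2 * N : ℤ) ∣ (k : ℕ) * ((l : ℕ) + (l' : ℕ) + 1) := fun k hk => by
      have := hp _ hk₀ _ hk
      simp only [dctMatrix_apply, zero_mul, Nat.cast_zero, Int.cast_zero, mul_zero, zero_div,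
        Real.cos_zero, Complex.ofReal_one, one_mul, mul_one, Complex.ofReal_inj] at this
      refine (dvd_of_cos_eq_cos hN0 this.symm).imp (fun hd => ?_) fun hd => ?_
      · obtain ⟨q, hq⟩ := hd
        push_cast at hq
        exact ⟨q, by linarith⟩
      · obtain ⟨q, hq⟩ := hd
        push_cast at hq
        exact ⟨q, by linarith⟩
    have h2N : (2 * N : ℤ) = 2 ^ (M + 2 + 1) := by rw [hNZ]; ring
    have hsh : l' = l.rev := by
      obtain ⟨k, hk, hk4⟩ := exists_not_four_dvd hh ⟨_, h4⟩ hpos R hR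
      have := hdvd k hk
      rw [h2N] at this
      refine hrev l l' hne ?_
      rw [hNZ]
      exact this.imp (two_pow_dvd_of_not_four_dvd hk4) (two_pow_dvd_of_not_four_dvd hk4)
    refine ⟨hsh, fun k hk => ?_⟩
    have hl' : ((l' : ℕ) : ℤ) = N - 1 - (l : ℕ) := by
      have := l.2
      rw [hsh, Fin.val_rev]; omega
    have h2 : (2 : ℤ) ∣ (k : ℕ) := by
      rcases hdvd k hk with hd | hd
      · rw [hl'] at hd
        -- `N` is even, so `l' - l = N - 1 - 2l` is odd.
        have hcop : IsCoprime (2 : ℤ) (N - 1 - (l : ℕ) - (l : ℕ)) :=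
          ⟨(l : ℕ) - h + 1, 1, by rw [hNc]; ring⟩
        exact hcop.dvd_of_dvd_mul_right ((dvd_mul_right _ _).trans hd)
      · rw [hl', show (l : ℤ) + (N - 1 - (l : ℕ)) + 1 = N by ring] at hd
        exact (mul_dvd_mul_iff_right (by exact_mod_cast hN0.ne')).1 hd
    simp only [evenRow, decide_eq_true_eq]
    omega
  · have h1 : (1 : ℕ) < N := by omega
    have h3 : (3 : ℕ) < N := by omega
    have hp' := hp ⟨1, h1⟩ (by simp [evenRow]) ⟨3, h3⟩ (by simp [evenRow])
    have ha := hne0 ⟨1, h1⟩ l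
    have hb := hne0 ⟨1, h1⟩ l'
    -- By the triple-angle formula, proportionality on rows 1 and 3 gives equal squared cosines,
    -- hence equal cosines of the doubled angles.
    have hthree : ∀ i : Fin N, dctMatrix N ⟨3, h3⟩ i =
        ((4 * Real.cos (Real.pi * ((2 * i + 1 : ℕ) : ℤ) / (2 * N)) ^ 3 -
          3 * Real.cos (Real.pi * ((2 * i + 1 : ℕ) : ℤ) / (2 * N)) : ℝ) : ℂ) := fun i => by
      rw [dctMatrix_apply, ← Real.cos_three_mul]
      congr 2
      push_cast
      ring
    rw [hthree, hthree] at hp'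
    rw [dctMatrix_apply] at ha hb
    simp only [dctMatrix_apply, one_mul] at hp' ha hb
    rw [Complex.ofReal_ne_zero] at ha hb
    set x := Real.pi * ((2 * l + 1 : ℕ) : ℤ) / (2 * N) with hx
    set y := Real.pi * ((2 * l' + 1 : ℕ) : ℤ) / (2 * N) with hy
    have hp'' : Real.cos x * (4 * Real.cos y ^ 3 - 3 * Real.cos y) =
      (4 * Real.cos x ^ 3 - 3 * Real.cos x) * Real.cos y := by exact_mod_cast hp'
    have hsq : Real.cos x ^ 2 = Real.cos y ^ 2 := by
      refine mul_left_cancel₀ (mul_ne_zero ha hb) ?_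
      linear_combination (-1 / 4) * hp''
    have hdouble : Real.cos (2 * x) = Real.cos (2 * y) := by
      rw [Real.cos_two_mul, Real.cos_two_mul, hsq]
    have hc := dvd_of_cos_eq_cos hN0 (A := 2 * (2 * l + 1 : ℕ)) (B := 2 * (2 * l' + 1 : ℕ)) (by
      convert hdouble using 2
      · rw [hx]; push_cast; ring
      · rw [hy]; push_cast; ring)
    refine hrev l l' hne (hc.imp (fun hd => ?_) fun hd => ?_)
    · obtain ⟨q, hq⟩ := hd
      push_cast at hq
      exact ⟨q, by linarith⟩
    · obtain ⟨q, hq⟩ := hd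
      push_cast at hq
      exact ⟨q, by linarith⟩

end DCT

/-! ### Reduction of DST-II to DCT-II, and the conclusion. -/

theorem dstMatrix_eq (N : ℕ) :
    dstMatrix N = Matrix.of fun k l => dctMatrix N (Fin.revPerm k) l * (-1) ^ (l : ℕ) := by
  ext k l
  have hN : (N : ℝ) ≠ 0 := by
    have := k.2
    exact_mod_cast (show N ≠ 0 by omega)
  -- As `k.rev = N - (k + 1)`, the angle is `lπ + π/2 - θ`, with `θ` the DST angle.
  have hcos : Real.cos (Real.pi / (N : ℝ) * (((l : ℕ) : ℝ) + 1 / 2) * ((k.rev : ℕ) : ℝ)) =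
      (-1) ^ (l : ℕ) *
        Real.sin (Real.pi / (N : ℝ) * (((l : ℕ) : ℝ) + 1 / 2) * (((k : ℕ) : ℝ) + 1)) := by
    rw [← Real.cos_pi_div_two_sub, ← Real.cos_add_nat_mul_pi, Fin.val_rev, Nat.cast_sub k.2]
    congr 1
    push_cast
    field_simp
    ring
  simp only [dstMatrix, dctMatrix, Matrix.of_apply, Fin.revPerm_apply, hcos]
  rcases Nat.even_or_odd l with hl | hl <;> simp [hl.neg_one_pow]

theorem mainTheorem1 (L N : ℕ) (hL : 2 ≤ L) (hN : N = 2 ^ L) :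
    (∀ Z : Matrix (Fin N) (Fin N) ℂ, Z = dftMatrix N ∨ Z = dctMatrix N ∨ Z = dstMatrix N →
      HasPSUniqueEMF
        (feasibleSet (columnSparse (Fin N) (Fin N) (N / 2) ×ˢ columnSparse (Fin N) (Fin N) 2)) Z) ∧
    HasPSUniqueEMF
      (feasibleSet (columnSparse (Fin N) (Fin N) 2 ×ˢ columnSparse (Fin N) (Fin N) (N / 2)))
      (dftMatrix N) := by
  have hh : N = 2 * (N / 2) := by
    have : 2 ∣ N := hN ▸ dvd_pow_self 2 (by omega)
    omega
  obtain ⟨_, _, _, _, hdft⟩ := dftMatrix_hasRigidHalves hL hN hh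
  obtain ⟨_, _, _, hdct⟩ := dctMatrix_hasRigidHalves hL hN hh
  constructor
  · rintro Z (rfl | rfl | rfl)
    · exact hdft.hasPSUniqueEMF
    · exact hdct.hasPSUniqueEMF
    · rw [dstMatrix_eq]
      exact (hdct.permute_scale Fin.revPerm (fun l => (-1) ^ (l : ℕ))
        fun l => pow_ne_zero _ (by simp)).hasPSUniqueEMF
  · rw [← transpose_dftMatrix]
    exact hdft.hasPSUniqueEMF.transpose
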